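/- **Setting.** Let $k\le n$ be non-negative integers and put $l=n-k$. Let $X$ be a scheme over a field $F$ of characteristic $0$ and let $\mathcal Q$ be a vector bundle of rank $k$ on $X$ (for instance the tautological rank $k$ quotient bundle of $\mathcal O^{\oplus n}$ on the Grassmannian $X=\mathrm{Gr}^{k,n}_S$ over a divisorial $F$-scheme $S$); write $\det\mathcal Q=\bigwedge^k\mathcal Q$. Let $Y(k,l)$ be the set of Young diagrams $\lambda=(\lambda_1,\dots,\lambda_k)$ with $l\ge\lambda_1\ge\dots\ge\lambda_k\ge0$. Let $\lambda^t=(\lambda^t_1,\dots,\lambda^t_l)$ be the transpose of $\lambda$, $d=|\lambda|$, and $\lambda^c=(l-\lambda_k,\dots,l-\lambda_1)$ its complement; $\lambda$ is called symmetric if $\lambda^c=\lambda$, in which case $\lambda^t_j+\lambda^t_{l+1-j}=k$ for all $j$. **Schur functor.** Put $\bigwedge^{\lambda^t}\mathcal Q=\bigotimes_j\bigwedge^{\lambda^t_j}\mathcal Q$ and $\mathrm{Sym}^\lambda\mathcal Q=\bigotimes_i\mathrm{Sym}^{\lambda_i}\mathcal Q$. Then $S^\lambda\mathcal Q$ is the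 image of the composite $$d_\lambda:\textstyle\bigwedge^{\lambda^t}\mathcal Q\to\mathcal Q^{\otimes d}\to\mathcal Q^{\otimes d}\to\mathrm{Sym}^\lambda\mathcal Q$$ of the antisymmetrization $x_1\wedge\dots\wedge x_r\mapsto\sum_\sigma\mathrm{sgn}(\sigma)\,x_{\sigma(1)}\otimes\dots\otimes x_{\sigma(r)}$ on each factor, the permutation of tensor factors passing from the boxes of $\lambda$ listed by columns to the boxes listed by rows, and the quotient map. **Canonical pairing.** Let $\lambda\in Y(k,l)$ be symmetric. Let $c_\lambda:S^\lambda\mathcal Q\to\bigwedge^{\lambda^t}\mathcal Q$ be the restriction to $S^\lambda\mathcal Q\subset\mathrm{Sym}^\lambda\mathcal Q$ of the composite $\mathrm{Sym}^\lambda\mathcal Q\to\mathcal Q^{\otimes d}\to\mathcal Q^{\otimes d}\to\bigwedge^{\lambda^t}\mathcal Q$ of the symmetrization $x_1\cdots x_r\mapsto\sum_\sigma x_{\sigma(1)}\otimes\dots\otimes x_{\sigma(r)}$ on each factor, the inverse permutation, and the quotient map (so $c_\lambda$ identifies the Schur functor with the Weyl functor inside $\bigwedge^{\lambda^t}\mathcal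 Q$). Let $\omega:\bigwedge^{\lambda^t}\mathcal Q\otimes\bigwedge^{\lambda^t}\mathcal Q\to(\det\mathcal Q)^{\otimes l}$ be the wedge pairing $$(x_1\otimes\dots\otimes x_l)\otimes(y_1\otimes\dots\otimes y_l)\mapsto(x_1\wedge y_l)\otimes(x_2\wedge y_{l-1})\otimes\dots\otimes(x_l\wedge y_1).$$ The canonical pairing is $\omega\circ(c_\lambda\otimes c_\lambda):S^\lambda\mathcal Q\otimes S^\lambda\mathcal Q\to(\det\mathcal Q)^{\otimes(n-k)}$. **Proposition.** Assume that $k(n-k)$ is even. Then for every symmetric $\lambda\in Y(k,n-k)$ the canonical pairing $S^\lambda\mathcal Q\otimes S^\lambda\mathcal Q\to(\det\mathcal Q)^{\otimes(n-k)}$ is skew-symmetric if $n-k$ is odd and $k\equiv2\pmod 4$, and it is symmetric in all other cases. -/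

import Mathlib

universe u

noncomputable section

namespace SchurPairing

open CategoryTheory MonoidalCategory TensorProduct PiTensorProduct

/-! ### Semilinear functoriality of multilinear constructions -/

section Semilinear

variable {A B : Type*} [CommRing A] [CommRing B] {φ : A →+* B}

/-- The map `⨂ᵢ xᵢ ↦ ⨂ᵢ gᵢ(xᵢ)` induced by semilinear maps `gᵢ`. -/
def piMapSemi {ι : Type*} {s t : ι → Type*} [∀ i, AddCommGroup (s i)] [∀ i, Module A (s i)]
    [∀ i, AddCommGroup (t i)] [∀ i, Module B (t i)] (g : ∀ i, s i →ₛₗ[φ] t i) :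
    (⨂[A] i, s i) →ₛₗ[φ] (⨂[B] i, t i) :=
  letI : Module A (⨂[B] i, t i) := Module.compHom _ φ
  let f : MultilinearMap A s (⨂[B] i, t i) :=
    { toFun := fun x => PiTensorProduct.tprod B (fun i => g i (x i))
      map_update_add' := by
        intro _ x i a b
        have h : ∀ c, (fun j => g j (Function.update x i c j)) =
            Function.update (fun j => g j (x j)) i (g i c) := fun c => by
          ext j
          exact Function.apply_update (fun j => g j) x i c j
        rw [h, h, h, map_add, MultilinearMap.map_update_add]
      map_update_smul' := by
        intro _ x i a b
        have h : ∀ c, (fun j => g j (Function.update x i c j)) =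
            Function.update (fun j => g j (x j)) i (g i c) := fun c => by
          ext j
          exact Function.apply_update (fun j => g j) x i c j
        rw [h, h, map_smulₛₗ, MultilinearMap.map_update_smul]
        rfl }
  { toFun := PiTensorProduct.lift f
    map_add' := map_add _
    map_smul' := fun r x => (PiTensorProduct.lift f).map_smul r x }

@[simp]
lemma piMapSemi_tprod {ι : Type*} {s t : ι → Type*} [∀ i, AddCommGroup (s i)]
    [∀ i, Module A (s i)] [∀ i, AddCommGroup (t i)] [∀ i, Module B (t i)]
    (g : ∀ i, s i →ₛₗ[φ] t i) (x : ∀ i, s i) :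
    piMapSemi g (PiTensorProduct.tprod A x) = PiTensorProduct.tprod B (fun i => g i (x i)) :=
  letI : Module A (⨂[B] i, t i) := Module.compHom _ φ
  PiTensorProduct.lift.tprod (R := A) x

variable {M N : Type*} [AddCommGroup M] [Module A M] [AddCommGroup N] [Module B N]

/-- The map `x₁ ∧ ⋯ ∧ xₙ ↦ g(x₁) ∧ ⋯ ∧ g(xₙ)` induced by a semilinear map `g`. -/
def extMapSemi (n : ℕ) (g : M →ₛₗ[φ] N) : (⋀[A]^n M) →ₛₗ[φ] (⋀[B]^n N) :=
  letI : Module A (⋀[B]^n N) := Module.compHom _ φ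
  let f : M [⋀^Fin n]→ₗ[A] (⋀[B]^n N) :=
    { toFun := fun x => exteriorPower.ιMulti B n (fun i => g (x i))
      map_update_add' := by
        intro _ x i a b
        have h : ∀ c, (fun j => g (Function.update x i c j)) =
            Function.update (fun j => g (x j)) i (g c) := fun c => by
          ext j
          exact Function.apply_update (fun _ => g) x i c j
        rw [h, h, h, map_add, AlternatingMap.map_update_add]
      map_update_smul' := by
        intro _ x i a b
        have h : ∀ c, (fun j => g (Function.update x i c j)) =
            Function.update (fun j => g (x j)) i (g c) := fun c => by
          ext j
          exact Function.apply_update (fun _ => g) x i c j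
        rw [h, h, map_smulₛₗ, AlternatingMap.map_update_smul]
        rfl
      map_eq_zero_of_eq' := fun x i j hij hne =>
        (exteriorPower.ιMulti B n).map_eq_zero_of_eq _ (congrArg g hij) hne }
  { toFun := exteriorPower.alternatingMapLinearEquiv f
    map_add' := map_add _
    map_smul' := fun r x => (exteriorPower.alternatingMapLinearEquiv f).map_smul r x }

@[simp]
lemma extMapSemi_ιMulti (n : ℕ) (g : M →ₛₗ[φ] N) (x : Fin n → M) :
    extMapSemi n g (exteriorPower.ιMulti A n x) = exteriorPower.ιMulti B n (fun i => g (x i)) :=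
  letI : Module A (⋀[B]^n N) := Module.compHom _ φ
  exteriorPower.alternatingMapLinearEquiv_apply_ιMulti (R := A) _ x

variable (A M) in
/-- The submodule of the `n`-th tensor power spanned by the differences of a pure tensor and
a permutation of it. -/
def symRel (n : ℕ) : Submodule A (⨂[A]^n M) :=
  Submodule.span A {t | ∃ (x : Fin n → M) (σ : Equiv.Perm (Fin n)),
    t = PiTensorProduct.tprod A x - PiTensorProduct.tprod A (fun i => x (σ i))}

variable (A M) in
/-- The `n`-th symmetric power of a module: the coinvariants of the `n`-th tensor power. -/
abbrev SymPow (n : ℕ) : Type _ := (⨂[A]^n M) ⧸ symRel A M n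

variable (A) in
/-- The product `x₁ ⋯ xₙ` in the `n`-th symmetric power. -/
def symProd {n : ℕ} (x : Fin n → M) : SymPow A M n :=
  (symRel A M n).mkQ (PiTensorProduct.tprod A x)

/-- The map `x₁ ⋯ xₙ ↦ g(x₁) ⋯ g(xₙ)` induced by a semilinear map `g`. -/
def symMapSemi (n : ℕ) (g : M →ₛₗ[φ] N) : SymPow A M n →ₛₗ[φ] SymPow B N n :=
  (symRel A M n).mapQ (symRel B N n) (piMapSemi fun _ : Fin n => g) (by
    refine Submodule.span_le.2 ?_
    rintro _ ⟨x, σ, rfl⟩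
    refine Submodule.subset_span ⟨fun i => g (x i), σ, ?_⟩
    simp)

@[simp]
lemma symMapSemi_symProd (n : ℕ) (g : M →ₛₗ[φ] N) (x : Fin n → M) :
    symMapSemi n g (symProd A x) = symProd B (fun i => g (x i)) := by
  change (symRel B N n).mkQ (piMapSemi (fun _ => g) (PiTensorProduct.tprod A x)) = _
  rw [piMapSemi_tprod]
  rfl

end Semilinear


/-! ### Linear algebra -/

section Linear

variable {A : Type*} [CommRing A] {M : Type*} [AddCommGroup M] [Module A M]

lemma span_smul_induction {M : Type*} [AddCommMonoid M] [Module A M] {ι : Type*} {v : ι → M} (hv : Submodule.span A (Set.range v) = ⊤)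
    {p : M → Prop} (h : ∀ (c : A) (i : ι), p (c • v i)) (h0 : p 0)
    (hadd : ∀ x y, p x → p y → p (x + y)) (x : M) : p x := by
  obtain ⟨c, rfl⟩ := Finsupp.mem_span_range_iff_exists_finsupp.1 (hv ▸ Submodule.mem_top : x ∈ _)
  induction c using Finsupp.induction_linear with
  | zero => simpa using h0
  | add c d hc hd =>
    rw [Finsupp.sum_add_index' (by simp) (by simp [add_smul])]
    exact hadd _ _ hc hd
  | single i r => simpa using h r i

lemma ext_induction {n : ℕ} {p : (⋀[A]^n M) → Prop}
    (h : ∀ (c : A) (x : Fin n → M), p (c • exteriorPower.ιMulti A n x))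
    (hadd : ∀ x y, p x → p y → p (x + y)) (x : ⋀[A]^n M) : p x :=
  span_smul_induction (exteriorPower.ιMulti_span A n M) h (by simpa using h 0 0) hadd x

lemma sym_induction {n : ℕ} {p : SymPow A M n → Prop}
    (h : ∀ (c : A) (x : Fin n → M), p (c • symProd A x))
    (hadd : ∀ x y, p x → p y → p (x + y)) (x : SymPow A M n) : p x := by
  obtain ⟨x, rfl⟩ := (symRel A M n).mkQ_surjective x
  induction x using PiTensorProduct.induction_on with
  | smul_tprod r x => exact h r x
  | add x y hx hy => exact hadd _ _ hx hy

lemma nested_tprod_span {m : ℕ} (μ : Fin m → ℕ) :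
    Submodule.span A (Set.range fun x : (∀ j, Fin (μ j) → M) =>
      PiTensorProduct.tprod A fun j => PiTensorProduct.tprod A (x j)) = ⊤ := by
  have key : ∀ (s : Finset (Fin m)) (t : ∀ j, ⨂[A]^(μ j) M),
      (∀ j ∉ s, ∃ x, t j = PiTensorProduct.tprod A x) → PiTensorProduct.tprod A t ∈
        Submodule.span A (Set.range fun x : (∀ j, Fin (μ j) → M) =>
          PiTensorProduct.tprod A fun j => PiTensorProduct.tprod A (x j)) := by
    intro s
    induction s using Finset.induction_on with
    | empty =>
      intro t ht
      choose x hx using fun j => ht j (Finset.notMem_empty j)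
      exact Submodule.subset_span ⟨x, by simp only [← hx]⟩
    | insert i s _ ih =>
      intro t ht
      rw [← Function.update_eq_self i t]
      generalize t i = u
      induction u using PiTensorProduct.induction_on with
      | smul_tprod r x =>
        rw [MultilinearMap.map_update_smul]
        refine Submodule.smul_mem _ _ (ih _ fun j hj => ?_)
        by_cases h : j = i
        · subst h
          exact ⟨x, by simp⟩
        · rw [Function.update_of_ne h]
          exact ht j (by simp [h, hj])
      | add x y hx hy =>
        rw [MultilinearMap.map_update_add]
        exact Submodule.add_mem _ hx hy
  rw [eq_top_iff, ← PiTensorProduct.span_tprod_eq_top]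
  refine Submodule.span_le.2 ?_
  rintro _ ⟨t, rfl⟩
  exact key Finset.univ t (by simp)

variable (A M) in
/-- The quotient map from the tensor power to the exterior power. -/
def tensorToExtLin (n : ℕ) : (⨂[A]^n M) →ₗ[A] ⋀[A]^n M :=
  PiTensorProduct.lift (exteriorPower.ιMulti A n).toMultilinearMap

variable (A M) in
/-- The map `x₁ ⋯ xₙ ↦ ∑ σ, x_{σ 1} ⊗ ⋯ ⊗ x_{σ n}`. -/
def symToTensorLin (n : ℕ) : SymPow A M n →ₗ[A] ⨂[A]^n M :=
  (symRel A M n).liftQ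
    (PiTensorProduct.lift (∑ σ : Equiv.Perm (Fin n),
      (PiTensorProduct.tprod A (s := fun _ : Fin n => M)).domDomCongr σ)) (by
    refine Submodule.span_le.2 ?_
    rintro _ ⟨x, τ, rfl⟩
    simp only [SetLike.mem_coe, LinearMap.mem_ker, map_sub, PiTensorProduct.lift.tprod,
      _root_.sum_apply, MultilinearMap.domDomCongr_apply, sub_eq_zero]
    exact (Fintype.sum_equiv (Equiv.mulLeft τ) _ _ fun σ => rfl).symm)

@[simp]
lemma symToTensorLin_symProd {n : ℕ} (x : Fin n → M) :
    symToTensorLin A M n (symProd A x) =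
      ∑ σ : Equiv.Perm (Fin n), PiTensorProduct.tprod A (fun i => x (σ i)) := by
  simp [symToTensorLin, symProd]

/-- The wedge product `⋀^a M × ⋀^b M → ⋀^c M`, where `a + b = c`. -/
def wedgeLin {a b c : ℕ} (h : a + b = c) : (⋀[A]^a M) →ₗ[A] (⋀[A]^b M) →ₗ[A] ⋀[A]^c M :=
  LinearMap.mk₂ A
    (fun x y => ⟨x.1 * y.1, h ▸ SetLike.mul_mem_graded (A := fun i => ⋀[A]^i M) x.2 y.2⟩)
    (fun x x' y => Subtype.ext (add_mul x.1 x'.1 y.1))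
    (fun r x y => Subtype.ext (smul_mul_assoc r x.1 y.1))
    (fun x y y' => Subtype.ext (mul_add x.1 y.1 y'.1))
    (fun r x y => Subtype.ext (mul_smul_comm r x.1 y.1))

lemma wedgeLin_ιMulti {a b c : ℕ} (h : a + b = c) (x : Fin a → M) (y : Fin b → M) :
    wedgeLin h (exteriorPower.ιMulti A a x) (exteriorPower.ιMulti A b y) =
      exteriorPower.ιMulti A c (Fin.append x y ∘ Fin.cast h.symm) := by
  subst h
  apply Subtype.ext
  change (exteriorPower.ιMulti A a x).1 * (exteriorPower.ιMulti A b y).1 = _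
  simp only [exteriorPower.ιMulti_apply_coe, ExteriorAlgebra.ιMulti_apply]
  rw [← List.prod_append, ← List.ofFn_fin_append]
  congr 2
  ext i
  refine Fin.addCases (fun i => ?_) (fun i => ?_) i <;> simp

lemma wedgeLin_extMapSemi {B : Type*} [CommRing B] {φ : A →+* B} {N : Type*} [AddCommGroup N]
    [Module B N] (g : M →ₛₗ[φ] N) {a b c : ℕ} (h : a + b = c) (x : ⋀[A]^a M) (y : ⋀[A]^b M) :
    wedgeLin h (extMapSemi a g x) (extMapSemi b g y) = extMapSemi c g (wedgeLin h x y) := by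
  induction x using ext_induction with
  | h r x =>
    induction y using ext_induction with
    | h s y =>
      simp only [map_smulₛₗ, extMapSemi_ιMulti, wedgeLin_ιMulti, LinearMap.smul_apply,
        RingHom.id_apply]
      congr 3
      ext i
      subst h
      refine Fin.addCases (fun i => ?_) (fun i => ?_) i <;> simp
    | hadd y z hy hz => simp only [map_add, hy, hz]
  | hadd x z hx hz => simp only [map_add, LinearMap.add_apply, hx, hz]

variable (A M) in
/-- The bilinear map
`(x₁ ⊗ ⋯ ⊗ xₘ, y₁ ⊗ ⋯ ⊗ yₘ) ↦ (x₁ ∧ yₘ) ⊗ ⋯ ⊗ (xₘ ∧ y₁)` on `⨂_j ⋀^{μ j} M`,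
for `μ j + μ (m + 1 - j) = k`. -/
def wedgePairingLin {m k : ℕ} (μ : Fin m → ℕ) (hμ : ∀ j, μ j + μ (Fin.rev j) = k) :
    (⨂[A] j, ⋀[A]^(μ j) M) →ₗ[A] (⨂[A] j, ⋀[A]^(μ j) M) →ₗ[A] ⨂[A]^m (⋀[A]^k M) :=
  (PiTensorProduct.map₂ fun j => wedgeLin (hμ j)).compl₂
    (PiTensorProduct.reindex A (fun j : Fin m => ⋀[A]^(μ j) M) Fin.revPerm).toLinearMap

@[simp]
lemma wedgePairingLin_tprod {m k : ℕ} (μ : Fin m → ℕ) (hμ : ∀ j, μ j + μ (Fin.rev j) = k)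
    (x y : ∀ j, ⋀[A]^(μ j) M) :
    wedgePairingLin A M μ hμ (PiTensorProduct.tprod A x) (PiTensorProduct.tprod A y) =
      PiTensorProduct.tprod A fun j => wedgeLin (hμ j) (x j) (y (Fin.rev j)) := by
  change PiTensorProduct.map₂ (fun j => wedgeLin (hμ j)) (PiTensorProduct.tprod A x)
    (PiTensorProduct.reindex A (fun j : Fin m => ⋀[A]^(μ j) M) Fin.revPerm
      (PiTensorProduct.tprod A y)) = _
  rw [PiTensorProduct.reindex_tprod]
  exact PiTensorProduct.map₂_tprod_tprod _ _ _

variable {E : Type*} [AddCommGroup E] [Module A E]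

/-- Splitting off the pairs `(0, i)` from the pairs `(j, i)` with `i < μ j`. -/
def sigmaFinSucc {m : ℕ} (μ : Fin (m + 1) → ℕ) :
    (Σ j, Fin (μ j)) ≃ Fin (μ 0) ⊕ (Σ j : Fin m, Fin (μ j.succ)) where
  toFun s := Fin.cases (motive := fun j => Fin (μ j) → _) Sum.inl
    (fun j i => Sum.inr ⟨j, i⟩) s.1 s.2
  invFun := Sum.elim (fun i => ⟨0, i⟩) (fun s => ⟨s.1.succ, s.2⟩)
  left_inv := by
    rintro ⟨j, i⟩
    induction j using Fin.cases <;> rfl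
  right_inv := by
    rintro (i | ⟨j, i⟩) <;> rfl

/-- A multilinear map in the variables `x_{j, i}` with `i < μ j` extends to a multilinear map in
variables `t_j` from the `μ j`-th tensor power. -/
def nestedLift : ∀ {m : ℕ} (μ : Fin m → ℕ),
    MultilinearMap A (fun _ : Σ j, Fin (μ j) => M) E →ₗ[A]
      MultilinearMap A (fun j => ⨂[A]^(μ j) M) E
  | 0, _ =>
    { toFun := fun f => MultilinearMap.constOfIsEmpty A _ (f isEmptyElim)
      map_add' := fun _ _ => rfl
      map_smul' := fun _ _ => rfl }
  | _ + 1, μ =>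
    { toFun := fun f => LinearMap.uncurryLeft (M := fun j => ⨂[A]^(μ j) M)
        (PiTensorProduct.lift ((nestedLift fun j => μ j.succ).compMultilinearMap
          (f.domDomCongr (sigmaFinSucc μ)).currySum))
      map_add' := fun f g => by
        have h : (nestedLift fun j => μ j.succ).compMultilinearMap
              ((f + g).domDomCongr (sigmaFinSucc μ)).currySum =
            (nestedLift fun j => μ j.succ).compMultilinearMap
              (f.domDomCongr (sigmaFinSucc μ)).currySum +
            (nestedLift fun j => μ j.succ).compMultilinearMap
              (g.domDomCongr (sigmaFinSucc μ)).currySum :=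
          MultilinearMap.ext fun x => (nestedLift fun j => μ j.succ).map_add
            ((f.domDomCongr (sigmaFinSucc μ)).currySum x)
            ((g.domDomCongr (sigmaFinSucc μ)).currySum x)
        rw [h, map_add]
        rfl
      map_smul' := fun r f => by
        have h : (nestedLift fun j => μ j.succ).compMultilinearMap
              ((r • f).domDomCongr (sigmaFinSucc μ)).currySum =
            r • (nestedLift fun j => μ j.succ).compMultilinearMap
              (f.domDomCongr (sigmaFinSucc μ)).currySum :=
          MultilinearMap.ext fun x => (nestedLift fun j => μ j.succ).map_smul r
            ((f.domDomCongr (sigmaFinSucc μ)).currySum x)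
        rw [h, map_smul]
        rfl }

lemma nestedLift_tprod {m : ℕ} (μ : Fin m → ℕ)
    (f : MultilinearMap A (fun _ : Σ j, Fin (μ j) => M) E) (x : ∀ j, Fin (μ j) → M) :
    nestedLift μ f (fun j => PiTensorProduct.tprod A (x j)) = f (fun s => x s.1 s.2) := by
  induction m with
  | zero =>
    change f isEmptyElim = _
    congr 1
    ext s
    exact s.1.elim0
  | succ m ih =>
    change PiTensorProduct.lift ((nestedLift fun j => μ j.succ).compMultilinearMap
      (f.domDomCongr (sigmaFinSucc μ)).currySum) (PiTensorProduct.tprod A (x 0))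
      (fun j => PiTensorProduct.tprod A (x j.succ)) = _
    rw [PiTensorProduct.lift.tprod]
    change nestedLift (fun j => μ j.succ) _ _ = _
    rw [ih]
    change f _ = _
    congr 1
    ext ⟨j, i⟩
    induction j using Fin.cases <;> rfl

variable (A M) in
/-- The canonical isomorphism `⨂_j M^{⊗ μ j} → M^{⊗ ∑ μ j}`. -/
def flattenLin {m : ℕ} (μ : Fin m → ℕ) :
    (⨂[A] j, ⨂[A]^(μ j) M) →ₗ[A] ⨂[A] _ : (Σ j, Fin (μ j)), M :=
  PiTensorProduct.lift (nestedLift μ (PiTensorProduct.tprod A))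

variable (A M) in
/-- The inverse of `flattenLin`. -/
def unflattenLin {m : ℕ} (μ : Fin m → ℕ) :
    (⨂[A] _ : (Σ j, Fin (μ j)), M) →ₗ[A] ⨂[A] j, ⨂[A]^(μ j) M :=
  PiTensorProduct.lift
    (MultilinearMap.compMultilinearMap (β := fun j => Fin (μ j)) (N := fun _ _ => M)
      (PiTensorProduct.tprod A) fun _ => PiTensorProduct.tprod A)

@[simp]
lemma flattenLin_tprod {m : ℕ} (μ : Fin m → ℕ) (x : ∀ j, Fin (μ j) → M) :
    flattenLin A M μ (PiTensorProduct.tprod A fun j => PiTensorProduct.tprod A (x j)) =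
      PiTensorProduct.tprod A (fun s : Σ j, Fin (μ j) => x s.1 s.2) := by
  rw [flattenLin, PiTensorProduct.lift.tprod, nestedLift_tprod]

@[simp]
lemma unflattenLin_tprod {m : ℕ} (μ : Fin m → ℕ) (x : (Σ j, Fin (μ j)) → M) :
    unflattenLin A M μ (PiTensorProduct.tprod A x) =
      PiTensorProduct.tprod A (fun j => PiTensorProduct.tprod A fun i => x ⟨j, i⟩) :=
  PiTensorProduct.lift.tprod x

end Linear

/-! ### Presheaves of modules -/

section Presheaf

universe v₁ u₁

variable {C : Type u₁} [Category.{v₁} C] {R : Cᵒᵖ ⥤ CommRingCat.{u}}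

variable (R) in
/-- Presheaves of modules over a presheaf of commutative rings. -/
abbrev PMod := PresheafOfModules.{u} (R ⋙ forget₂ CommRingCat RingCat)

/-- Sections over `U`, as a module over the commutative ring `R(U)`. -/
abbrev sec (M : PMod R) (U : Cᵒᵖ) : ModuleCat.{u} (R.obj U) := M.obj U

/-- Restriction of sections, as a semilinear map. -/
def res (M : PMod R) {U V : Cᵒᵖ} (f : U ⟶ V) : sec M U →ₛₗ[(R.map f).hom] sec M V :=
  M.restrictₛₗ f

@[simp]
lemma res_id (M : PMod R) (U : Cᵒᵖ) (x : sec M U) : res M (𝟙 U) x = x := by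
  change M.map (𝟙 U) x = x
  rw [M.map_id]
  rfl

@[simp]
lemma res_comp (M : PMod R) {U V W : Cᵒᵖ} (f : U ⟶ V) (g : V ⟶ W) (x : sec M U) :
    res M (f ≫ g) x = res M g (res M f x) :=
  M.map_comp_apply f g x

/-- A presheaf of modules from modules of sections and semilinear restriction maps. -/
def mkPMod (obj : ∀ U : Cᵒᵖ, ModuleCat.{u} (R.obj U))
    (r : ∀ {U V : Cᵒᵖ} (f : U ⟶ V), obj U →ₛₗ[(R.map f).hom] obj V)
    (r_id : ∀ (U : Cᵒᵖ) (x : obj U), r (𝟙 U) x = x)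
    (r_comp : ∀ {U V W : Cᵒᵖ} (f : U ⟶ V) (g : V ⟶ W) (x : obj U),
      r (f ≫ g) x = r g (r f x)) : PMod R where
  obj U := obj U
  map {U V} f := ModuleCat.semilinearMapAddEquiv (R.map f).hom (obj U) (obj V) (r f)
  map_id U := by
    ext x
    exact r_id U x
  map_comp f g := by
    ext x
    exact r_comp f g x

/-- A morphism of presheaves of modules from linear maps compatible with restriction. -/
def mkHom {M N : PMod R} (f : ∀ U : Cᵒᵖ, sec M U →ₗ[R.obj U] sec N U)
    (h : ∀ {U V : Cᵒᵖ} (g : U ⟶ V) (x : sec M U), f V (res M g x) = res N g (f U x)) : M ⟶ N where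
  app U := ModuleCat.ofHom (f U)
  naturality g := by
    ext x
    exact h g x

/-- The linear map on sections over `U` of a morphism of presheaves of modules. -/
def homLin {M N : PMod R} (f : M ⟶ N) (U : Cᵒᵖ) : sec M U →ₗ[R.obj U] sec N U := (f.app U).hom

lemma homLin_res {M N : PMod R} (f : M ⟶ N) {U V : Cᵒᵖ} (g : U ⟶ V) (x : sec M U) :
    homLin f V (res M g x) = res N g (homLin f U x) :=
  PresheafOfModules.naturality_apply f g x

/-- A morphism out of a tensor product of two presheaves of modules from bilinear maps compatible
with restriction. -/
def mkPairing {M N L : PMod R} (f : ∀ U : Cᵒᵖ, sec M U →ₗ[R.obj U] sec N U →ₗ[R.obj U] sec L U)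
    (h : ∀ {U V : Cᵒᵖ} (g : U ⟶ V) (x : sec M U) (y : sec N U),
      f V (res M g x) (res N g y) = res L g (f U x y)) : M ⊗ N ⟶ L :=
  mkHom (fun U => (TensorProduct.lift (f U) : (sec M U ⊗[R.obj U] sec N U) →ₗ[R.obj U] sec L U))
    (fun {U V} g => by
      let ρ : (sec M U ⊗[R.obj U] sec N U) →ₛₗ[(R.map g).hom] (sec M V ⊗[R.obj V] sec N V) :=
        res (M ⊗ N) g
      have key : ∀ x, TensorProduct.lift (f V) (ρ x) = res L g (TensorProduct.lift (f U) x) := by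
        intro x
        induction x using TensorProduct.induction_on with
        | zero => simp only [map_zero]
        | add x y hx hy => simp only [map_add, hx, hy]
        | tmul x y => exact h g x y
      exact key)

/-- The tensor product `⨂ᵢ Mᵢ` of a family of presheaves of modules. -/
def piTensor {ι : Type} (M : ι → PMod R) : PMod R :=
  mkPMod (fun U => ModuleCat.of _ (⨂[R.obj U] i, sec (M i) U))
    (fun f => piMapSemi fun i => res (M i) f)
    (fun U x => by
      induction x using PiTensorProduct.induction_on with
      | smul_tprod r x => simp [map_smulₛₗ]
      | add x y hx hy => rw [map_add, hx, hy])
    (fun f g x => by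
      induction x using PiTensorProduct.induction_on with
      | smul_tprod r x => simp [map_smulₛₗ]
      | add x y hx hy => rw [map_add, hx, hy, map_add, map_add])

/-- The presheaf `U ↦ ⋀ⁿ M(U)`. -/
def extPow (n : ℕ) (M : PMod R) : PMod R :=
  mkPMod (fun U => ModuleCat.of _ (⋀[R.obj U]^n (sec M U)))
    (fun f => extMapSemi n (res M f))
    (fun U x => by
      induction x using ext_induction with
      | h r x => simp [map_smulₛₗ]
      | hadd x y hx hy => rw [map_add, hx, hy])
    (fun f g x => by
      induction x using ext_induction with
      | h r x => simp [map_smulₛₗ]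
      | hadd x y hx hy => rw [map_add, hx, hy, map_add, map_add])

/-- The presheaf `U ↦ Symⁿ M(U)`. -/
def symPow (n : ℕ) (M : PMod R) : PMod R :=
  mkPMod (fun U => ModuleCat.of _ (SymPow (R.obj U) (sec M U) n))
    (fun f => symMapSemi n (res M f))
    (fun U x => by
      induction x using sym_induction with
      | h r x => simp [map_smulₛₗ]
      | hadd x y hx hy => rw [map_add, hx, hy])
    (fun f g x => by
      induction x using sym_induction with
      | h r x => simp [map_smulₛₗ]
      | hadd x y hx hy => rw [map_add, hx, hy, map_add, map_add])

/-- The tensor product of a family of morphisms. -/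
def piTensorMap {ι : Type} {M N : ι → PMod R} (f : ∀ i, M i ⟶ N i) : piTensor M ⟶ piTensor N :=
  mkHom (fun U => PiTensorProduct.map fun i => homLin (f i) U) (fun {U V} g x => by
    change (⨂[R.obj U] i, sec (M i) U : Type _) at x
    change PiTensorProduct.map (fun i => homLin (f i) V) (piMapSemi (fun i => res (M i) g) x) =
      piMapSemi (fun i => res (N i) g) (PiTensorProduct.map (fun i => homLin (f i) U) x)
    induction x using PiTensorProduct.induction_on with
    | smul_tprod r x => simp [map_smulₛₗ, homLin_res]
    | add x y hx hy => simp only [map_add, hx, hy])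

/-- The `ι`-th tensor power of a presheaf of modules. -/
abbrev tensorPow (ι : Type) (M : PMod R) : PMod R := piTensor fun _ : ι => M

/-- Permuting the factors of a tensor power: the factor at `i` is moved to `e i`. -/
def tensorReindex {ι κ : Type} (e : ι ≃ κ) (M : PMod R) : tensorPow ι M ⟶ tensorPow κ M :=
  mkHom (fun U => (PiTensorProduct.reindex (R.obj U) (fun _ : ι => sec M U) e).toLinearMap)
    (fun {U V} g x => by
      change (⨂[R.obj U] _ : ι, sec M U : Type _) at x
      change PiTensorProduct.reindex (R.obj V) (fun _ : ι => sec M V) e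
          (piMapSemi (fun _ => res M g) x) =
        piMapSemi (fun _ => res M g) (PiTensorProduct.reindex (R.obj U) (fun _ : ι => sec M U) e x)
      induction x using PiTensorProduct.induction_on with
      | smul_tprod r x => simp [map_smulₛₗ]
      | add x y hx hy => simp only [map_add, hx, hy])

/-- The canonical isomorphism `⨂_j M^{⊗ μ j} → M^{⊗ ∑ μ j}`, where the factors of the target are
indexed by pairs `(j, i)` with `i < μ j`. -/
def flatten {m : ℕ} (μ : Fin m → ℕ) (M : PMod R) :
    (piTensor fun j => tensorPow (Fin (μ j)) M) ⟶ tensorPow (Σ j, Fin (μ j)) M :=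
  mkHom (fun U => flattenLin (R.obj U) (sec M U) μ) (fun {U V} g x => by
    change (⨂[R.obj U] j, ⨂[R.obj U]^(μ j) (sec M U) : Type _) at x
    change flattenLin (R.obj V) (sec M V) μ (piMapSemi (fun _ => piMapSemi fun _ => res M g) x) =
      piMapSemi (fun _ => res M g) (flattenLin (R.obj U) (sec M U) μ x)
    induction x using span_smul_induction (nested_tprod_span μ) with
    | h r x => simp [map_smulₛₗ]
    | h0 => simp only [map_zero]
    | hadd x y hx hy => simp only [map_add, hx, hy])

/-- The inverse of `flatten`. -/
def unflatten {m : ℕ} (μ : Fin m → ℕ) (M : PMod R) :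
    tensorPow (Σ j, Fin (μ j)) M ⟶ piTensor fun j => tensorPow (Fin (μ j)) M :=
  mkHom (fun U => unflattenLin (R.obj U) (sec M U) μ) (fun {U V} g x => by
    change (⨂[R.obj U] _ : (Σ j, Fin (μ j)), sec M U : Type _) at x
    change unflattenLin (R.obj V) (sec M V) μ (piMapSemi (fun _ => res M g) x) =
      piMapSemi (fun _ => piMapSemi fun _ => res M g) (unflattenLin (R.obj U) (sec M U) μ x)
    induction x using PiTensorProduct.induction_on with
    | smul_tprod r x => simp [map_smulₛₗ]
    | add x y hx hy => simp only [map_add, hx, hy])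

/-- The inclusion `⋀ⁿ M → M^{⊗ n}`,
`x₁ ∧ ⋯ ∧ xₙ ↦ ∑ σ, sign σ • x_{σ 1} ⊗ ⋯ ⊗ x_{σ n}`. -/
def extToTensor (n : ℕ) (M : PMod R) : extPow n M ⟶ tensorPow (Fin n) M :=
  mkHom (fun U => exteriorPower.toTensorPower (R.obj U) (sec M U) n) (fun {U V} g x => by
    change (⋀[R.obj U]^n (sec M U) : Submodule _ _) at x
    change exteriorPower.toTensorPower (R.obj V) (sec M V) n (extMapSemi n (res M g) x) =
      piMapSemi (fun _ => res M g) (exteriorPower.toTensorPower (R.obj U) (sec M U) n x)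
    induction x using ext_induction with
    | h r x => simp [map_smulₛₗ]
    | hadd x y hx hy => simp only [map_add, hx, hy])

/-- The quotient map `M^{⊗ n} → ⋀ⁿ M`. -/
def tensorToExt (n : ℕ) (M : PMod R) : tensorPow (Fin n) M ⟶ extPow n M :=
  mkHom (fun U => tensorToExtLin (R.obj U) (sec M U) n) (fun {U V} g x => by
    change (⨂[R.obj U]^n (sec M U) : Type _) at x
    change tensorToExtLin (R.obj V) (sec M V) n (piMapSemi (fun _ => res M g) x) =
      extMapSemi n (res M g) (tensorToExtLin (R.obj U) (sec M U) n x)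
    induction x using PiTensorProduct.induction_on with
    | smul_tprod r x => simp [map_smulₛₗ, tensorToExtLin]
    | add x y hx hy => simp only [map_add, hx, hy])

/-- The quotient map `M^{⊗ n} → Symⁿ M`. -/
def tensorToSym (n : ℕ) (M : PMod R) : tensorPow (Fin n) M ⟶ symPow n M :=
  mkHom (fun U => (symRel (R.obj U) (sec M U) n).mkQ) (fun _ _ => rfl)

/-- The map `Symⁿ M → M^{⊗ n}`, `x₁ ⋯ xₙ ↦ ∑ σ, x_{σ 1} ⊗ ⋯ ⊗ x_{σ n}`. -/
def symToTensor (n : ℕ) (M : PMod R) : symPow n M ⟶ tensorPow (Fin n) M :=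
  mkHom (fun U => symToTensorLin (R.obj U) (sec M U) n) (fun {U V} g x => by
    change (SymPow (R.obj U) (sec M U) n) at x
    change symToTensorLin (R.obj V) (sec M V) n (symMapSemi n (res M g) x) =
      piMapSemi (fun _ => res M g) (symToTensorLin (R.obj U) (sec M U) n x)
    induction x using sym_induction with
    | h r x => simp [map_smulₛₗ]
    | hadd x y hx hy => simp only [map_add, hx, hy])

/-- The presheaf `U ↦ ⨂_j ⋀^{μ j} M(U)`. -/
abbrev extTensor {m : ℕ} (μ : Fin m → ℕ) (M : PMod R) : PMod R :=
  piTensor fun j => extPow (μ j) M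

/-- The presheaf `U ↦ ⨂_i Sym^{μ i} M(U)`. -/
abbrev symTensor {m : ℕ} (μ : Fin m → ℕ) (M : PMod R) : PMod R :=
  piTensor fun i => symPow (μ i) M

/-- The pairing `(⨂_j ⋀^{μ j} M) ⊗ (⨂_j ⋀^{μ j} M) → (⋀^k M)^{⊗ m}`,
`(x₁ ⊗ ⋯ ⊗ xₘ) ⊗ (y₁ ⊗ ⋯ ⊗ yₘ) ↦ (x₁ ∧ yₘ) ⊗ ⋯ ⊗ (xₘ ∧ y₁)`, for `μ j + μ (m + 1 - j) = k`. -/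
def wedgePairing {m k : ℕ} (μ : Fin m → ℕ) (hμ : ∀ j, μ j + μ (Fin.rev j) = k) (M : PMod R) :
    extTensor μ M ⊗ extTensor μ M ⟶ tensorPow (Fin m) (extPow k M) :=
  mkPairing (fun U => wedgePairingLin (R.obj U) (sec M U) μ hμ) (fun {U V} g x y => by
    change (⨂[R.obj U] j, ⋀[R.obj U]^(μ j) (sec M U) : Type _) at x y
    change wedgePairingLin (R.obj V) (sec M V) μ hμ
        (piMapSemi (fun j => extMapSemi (μ j) (res M g)) x)
        (piMapSemi (fun j => extMapSemi (μ j) (res M g)) y) =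
      piMapSemi (fun _ => extMapSemi k (res M g)) (wedgePairingLin (R.obj U) (sec M U) μ hμ x y)
    induction x using PiTensorProduct.induction_on with
    | smul_tprod r x =>
      induction y using PiTensorProduct.induction_on with
      | smul_tprod s y => simp [map_smulₛₗ, wedgeLin_extMapSemi]
      | add y z hy hz => simp only [map_add, hy, hz]
    | add x z hx hz => simp only [map_add, LinearMap.add_apply, hx, hz])

end Presheaf

/-! ### Young diagrams -/

section Young

/-- Young diagrams with at most `k` rows and at most `l` columns. -/
@[ext]
structure YoungIn (k l : ℕ) where
  /-- The length of the `i`-th row. -/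
  row : Fin k → ℕ
  anti : Antitone row
  le : ∀ i, row i ≤ l

namespace YoungIn

variable {k l : ℕ} (lam : YoungIn k l)

/-- The complement of a Young diagram in the `k × l` rectangle. -/
def compl : YoungIn k l where
  row i := l - lam.row (Fin.rev i)
  anti _ _ h := Nat.sub_le_sub_left (lam.anti (Fin.rev_le_rev.2 h)) l
  le _ := Nat.sub_le _ _

/-- A Young diagram is symmetric if it equals its complement. -/
def IsSymmetric : Prop := lam.compl = lam

/-- The length of the `j`-th column, i.e. of the `j`-th row of the transposed diagram. -/
def col (j : Fin l) : ℕ := (Finset.univ.filter fun i : Fin k => (j : ℕ) < lam.row i).card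

lemma col_le (j : Fin l) : lam.col j ≤ k :=
  (Finset.card_filter_le _ _).trans (by simp)

lemma lt_col_iff (i : Fin k) (j : Fin l) : (i : ℕ) < lam.col j ↔ (j : ℕ) < lam.row i := by
  constructor
  · intro h
    by_contra hj
    have : (Finset.univ.filter fun i : Fin k => (j : ℕ) < lam.row i) ⊆ Finset.Iio i := by
      intro a ha
      rw [Finset.mem_Iio]
      by_contra hia
      have h1 := lam.anti (not_lt.1 hia)
      have h2 := (Finset.mem_filter.1 ha).2
      omega
    have := Finset.card_le_card this
    rw [Fin.card_Iio] at this
    exact absurd h (not_lt.2 this)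
  · intro h
    have : Finset.Iic i ⊆ (Finset.univ.filter fun i : Fin k => (j : ℕ) < lam.row i) := by
      intro a ha
      exact Finset.mem_filter.2 ⟨Finset.mem_univ _, h.trans_le (lam.anti (Finset.mem_Iic.1 ha))⟩
    have := Finset.card_le_card this
    rw [Fin.card_Iic] at this
    exact this

/-- The bijection `(j, i) ↦ (i, j)` between the boxes listed by columns and the boxes listed
by rows. -/
def boxes : (Σ j, Fin (lam.col j)) ≃ (Σ i, Fin (lam.row i)) where
  toFun s := ⟨⟨s.2, s.2.2.trans_le (lam.col_le s.1)⟩,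
    ⟨s.1, (lam.lt_col_iff ⟨s.2, s.2.2.trans_le (lam.col_le s.1)⟩ s.1).1 s.2.2⟩⟩
  invFun s := ⟨⟨s.2, s.2.2.trans_le (lam.le s.1)⟩,
    ⟨s.1, (lam.lt_col_iff s.1 ⟨s.2, s.2.2.trans_le (lam.le s.1)⟩).2 s.2.2⟩⟩
  left_inv _ := rfl
  right_inv _ := rfl

lemma IsSymmetric.col_add_col {lam : YoungIn k l} (h : lam.IsSymmetric) (j : Fin l) :
    lam.col j + lam.col (Fin.rev j) = k := by
  have hrow : ∀ i, lam.row i = l - lam.row (Fin.rev i) := fun i =>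
    (congrFun (congrArg YoungIn.row h) i).symm
  have h2 : lam.col (Fin.rev j) =
      (Finset.univ.filter fun i : Fin k => ¬ (j : ℕ) < lam.row i).card := by
    refine Finset.card_equiv Fin.revPerm fun i => ?_
    have h3 := hrow i
    have h4 := lam.le (Fin.rev i)
    have h5 := j.2
    simp only [Finset.mem_filter, Finset.mem_univ, true_and, Fin.val_rev, Fin.revPerm_apply]
    omega
  rw [h2, col, Finset.card_filter_add_card_filter_not]
  simp

end YoungIn

end Young

/-! ### The Schur functor on presheaves -/

section Schur

universe v₁ u₁

variable {C : Type u₁} [Category.{v₁} C] {R : Cᵒᵖ ⥤ CommRingCat.{u}} {k l : ℕ}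

/-- The map `d_λ : ⋀^{λᵗ} M → M^{⊗ d} → M^{⊗ d} → Sym^λ M`: the inclusion, then the permutation
of the factors that passes from the boxes of `λ` read by columns to the boxes read by rows, then
the quotient map. -/
def schurMap (lam : YoungIn k l) (M : PMod R) : extTensor lam.col M ⟶ symTensor lam.row M :=
  piTensorMap (fun j => extToTensor (lam.col j) M) ≫ flatten lam.col M ≫
    tensorReindex lam.boxes M ≫ unflatten lam.row M ≫
      piTensorMap (fun i => tensorToSym (lam.row i) M)

/-- The map `Sym^λ M → M^{⊗ d} → M^{⊗ d} → ⋀^{λᵗ} M` in the opposite direction. When symmetric and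
divided powers are identified (in characteristic zero), its image is the Weyl functor of `λ`. -/
def weylMap (lam : YoungIn k l) (M : PMod R) : symTensor lam.row M ⟶ extTensor lam.col M :=
  piTensorMap (fun i => symToTensor (lam.row i) M) ≫ flatten lam.row M ≫
    tensorReindex lam.boxes.symm M ≫ unflatten lam.col M ≫
      piTensorMap (fun j => tensorToExt (lam.col j) M)

end Schur

/-! ### Tensor products of sheaves -/

section Local

universe v₁ u₁

open Opposite

variable {C : Type u₁} [Category.{v₁} C] {R : Cᵒᵖ ⥤ CommRingCat.{u}} (J : GrothendieckTopology C)

/-- Every section of the kernel vanishes locally and every section of the target lifts locally. -/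
structure IsLocBij {M N : PMod R} (f : M ⟶ N) : Prop where
  inj : ∀ (U : C) (x : sec M (op U)), homLin f (op U) x = 0 →
    ∃ S ∈ J U, ∀ (V : C) (g : V ⟶ U), S g → res M g.op x = 0
  surj : ∀ (U : C) (y : sec N (op U)),
    ∃ S ∈ J U, ∀ (V : C) (g : V ⟶ U), S g → ∃ x, homLin f (op V) x = res N g.op y

lemma isLocBij_iff {M N : PMod R} (f : M ⟶ N) : IsLocBij J f ↔
    Presheaf.IsLocallyInjective J ((PresheafOfModules.toPresheaf _).map f) ∧
      Presheaf.IsLocallySurjective J ((PresheafOfModules.toPresheaf _).map f) := by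
  constructor
  · intro h
    refine ⟨⟨fun {U} x y hxy => ?_⟩, ⟨fun {U} y => ?_⟩⟩
    · change sec M U at x y
      change homLin f U x = homLin f U y at hxy
      obtain ⟨S, hS, hS'⟩ := h.inj U.unop (x - y) (by
        change homLin f U (x - y) = 0
        rw [map_sub, hxy, sub_self])
      refine J.superset_covering (fun V g hg => ?_) hS
      have := hS' V g hg
      rw [map_sub, sub_eq_zero] at this
      exact this
    · obtain ⟨S, hS, hS'⟩ := h.surj U y
      exact J.superset_covering (fun V g hg => hS' V g hg) hS
  · rintro ⟨h1, h2⟩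
    refine ⟨fun U x hx => ?_, fun U y => ?_⟩
    · refine ⟨_, Presheaf.equalizerSieve_mem J ((PresheafOfModules.toPresheaf _).map f)
        (X := op U) x (0 : sec M (op U)) ?_, fun V g hg => ?_⟩
      · change homLin f (op U) x = homLin f (op U) 0
        rw [hx, map_zero]
      · have : res M g.op x = res M g.op 0 := hg
        rw [this, map_zero]
    · exact ⟨_, Presheaf.imageSieve_mem J ((PresheafOfModules.toPresheaf _).map f)
        (U := op U) y, fun V g hg => by
        obtain ⟨x, hx⟩ := hg
        exact ⟨x, hx⟩⟩

lemma exists_relation {A M M' N : Type*} [CommRing A] [AddCommGroup M] [Module A M]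
    [AddCommGroup M'] [Module A M'] [AddCommGroup N] [Module A N] (f : M →ₗ[A] M')
    (x : N ⊗[A] M) (hx : f.lTensor N x = 0) :
    ∃ (r s : ℕ) (n : Fin r → N) (p : Fin r → M) (a : Fin r → Fin s → A) (y : Fin s → M'),
      x = ∑ i, n i ⊗ₜ[A] p i ∧ (∀ i, f (p i) = ∑ j, a i j • y j) ∧
        ∀ j, ∑ i, a i j • n i = 0 := by
  obtain ⟨P, hP, t, rfl⟩ := TensorProduct.exists_of_fg x
  have h1 : P.subtype.rTensor M' (f.lTensor P t) = 0 := by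
    rw [← hx, ← LinearMap.comp_apply, ← LinearMap.comp_apply, LinearMap.rTensor_comp_lTensor,
      LinearMap.lTensor_comp_rTensor]
  obtain ⟨Q, hPQ, hQ, h2⟩ := TensorProduct.eq_zero_of_fg_of_subtype_eq_zero hP h1
  obtain ⟨r, q, hq⟩ := Submodule.fg_iff_exists_fin_generating_family.1
    (Module.Finite.iff_fg.2 hQ).fg_top
  have h3 : ∀ u : Q ⊗[A] M, ∃ p : Fin r → M, u = ∑ i, q i ⊗ₜ[A] p i := by
    intro u
    induction u using TensorProduct.induction_on with
    | zero => exact ⟨0, by simp⟩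
    | tmul b m =>
      obtain ⟨c, hc⟩ := (Submodule.mem_span_range_iff_exists_fun A).1
        (hq ▸ Submodule.mem_top : b ∈ Submodule.span A (Set.range q))
      refine ⟨fun i => c i • m, ?_⟩
      rw [← hc, TensorProduct.sum_tmul]
      simp only [TensorProduct.smul_tmul]
    | add u v hu hv =>
      obtain ⟨p, rfl⟩ := hu
      obtain ⟨p', rfl⟩ := hv
      exact ⟨p + p', by simp [TensorProduct.tmul_add, Finset.sum_add_distrib]⟩
  obtain ⟨p, hp⟩ := h3 ((Submodule.inclusion hPQ).rTensor M t)
  have h4 : ∑ i, q i ⊗ₜ[A] f (p i) = 0 := by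
    have := congrArg (f.lTensor Q) hp
    rw [← LinearMap.comp_apply, LinearMap.lTensor_comp_rTensor,
      ← LinearMap.rTensor_comp_lTensor, LinearMap.comp_apply, h2] at this
    simpa using this.symm
  obtain ⟨s, a, y, h5, h6⟩ := TensorProduct.vanishesTrivially_of_sum_tmul_eq_zero A hq h4
  refine ⟨r, s, fun i => q i, p, a, y, ?_, h5, fun j => ?_⟩
  · have := congrArg (Q.subtype.rTensor M) hp
    rw [← LinearMap.comp_apply, ← LinearMap.rTensor_comp] at this
    rw [show P.subtype = Q.subtype ∘ₗ Submodule.inclusion hPQ from rfl, this]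
    simp
  · have := congrArg Q.subtype (h6 j)
    simpa using this

lemma IsLocBij.exists_lifts {M N : PMod R} {f : M ⟶ N} (h : IsLocBij J f) {s : ℕ} (U : C)
    (y : Fin s → sec N (op U)) :
    ∃ S ∈ J U, ∀ (V : C) (g : V ⟶ U), S g → ∀ j, ∃ x, homLin f (op V) x = res N g.op (y j) := by
  induction s with
  | zero => exact ⟨⊤, J.top_mem U, fun V g _ j => j.elim0⟩
  | succ s ih =>
    obtain ⟨S, hS, hS'⟩ := ih fun j => y j.succ
    obtain ⟨T, hT, hT'⟩ := h.surj U (y 0)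
    refine ⟨S ⊓ T, J.intersection_covering hS hT, fun V g hg j => ?_⟩
    induction j using Fin.cases with
    | zero => exact hT' V g hg.2
    | succ j => exact hS' V g hg.1 j

lemma IsLocBij.exists_vanish {M N : PMod R} {f : M ⟶ N} (h : IsLocBij J f) {s : ℕ} (U : C)
    (x : Fin s → sec M (op U)) (hx : ∀ j, homLin f (op U) (x j) = 0) :
    ∃ S ∈ J U, ∀ (V : C) (g : V ⟶ U), S g → ∀ j, res M g.op (x j) = 0 := by
  induction s with
  | zero => exact ⟨⊤, J.top_mem U, fun V g _ j => j.elim0⟩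
  | succ s ih =>
    obtain ⟨S, hS, hS'⟩ := ih (fun j => x j.succ) fun j => hx j.succ
    obtain ⟨T, hT, hT'⟩ := h.inj U (x 0) (hx 0)
    refine ⟨S ⊓ T, J.intersection_covering hS hT, fun V g hg j => ?_⟩
    induction j using Fin.cases with
    | zero => exact hT' V g hg.2
    | succ j => exact hS' V g hg.1 j

/-- Restriction of sections of a tensor product. -/
def resTensor (N M : PMod R) {U V : Cᵒᵖ} (g : U ⟶ V) :
    (sec N U ⊗[R.obj U] sec M U) →ₛₗ[(R.map g).hom] (sec N V ⊗[R.obj V] sec M V) :=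
  res (N ⊗ M) g

@[simp]
lemma resTensor_tmul (N M : PMod R) {U V : Cᵒᵖ} (g : U ⟶ V) (n : sec N U) (m : sec M U) :
    resTensor N M g (n ⊗ₜ m) = res N g n ⊗ₜ res M g m :=
  rfl

lemma isLocBij_whiskerLeft {M M' : PMod R} {f : M ⟶ M'} (h : IsLocBij J f) (N : PMod R) :
    IsLocBij J (N ◁ f) where
  inj U x hx := by
    change (sec N (op U) ⊗[R.obj (op U)] sec M (op U) : Type _) at x
    change (homLin f (op U)).lTensor (sec N (op U)) x = 0 at hx
    change ∃ S ∈ J U, ∀ (V : C) (g : V ⟶ U), S g → resTensor N M g.op x = 0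
    obtain ⟨r, s, n, p, a, y, rfl, hp, hn⟩ := exists_relation _ x hx
    obtain ⟨S, hS, hS'⟩ := h.exists_lifts J U y
    have key : ∀ (V : C) (g : V ⟶ U), S g → ∃ T ∈ J V, ∀ (W : C) (g' : W ⟶ V), T g' →
        resTensor N M (g' ≫ g).op (∑ i, n i ⊗ₜ[R.obj (op U)] p i) = 0 := by
      intro V g hg
      choose z hz using hS' V g hg
      obtain ⟨T, hT, hT'⟩ := h.exists_vanish J V
        (fun i => res M g.op (p i) - ∑ j, (R.map g.op).hom (a i j) • z j) (fun i => by
          rw [map_sub, homLin_res, hp, map_sum, map_sum, sub_eq_zero]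
          simp only [map_smulₛₗ, hz, RingHom.id_apply])
      refine ⟨T, hT, fun W g' hg' => ?_⟩
      have h1 : ∀ i, res M (g' ≫ g).op (p i) =
          ∑ j, (R.map (g' ≫ g).op).hom (a i j) • res M g'.op (z j) := by
        intro i
        have := hT' W g' hg' i
        rw [map_sub, sub_eq_zero] at this
        rw [op_comp, res_comp, this, map_sum]
        simp [map_smulₛₗ]
      have h2 : ∀ j, ∑ i, (R.map (g' ≫ g).op).hom (a i j) • res N (g' ≫ g).op (n i) = 0 := by
        intro j
        have := congrArg (res N (g' ≫ g).op) (hn j)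
        simpa only [map_sum, map_smulₛₗ, map_zero] using this
      rw [map_sum]
      simp only [resTensor_tmul, h1, TensorProduct.tmul_sum, TensorProduct.tmul_smul]
      rw [Finset.sum_comm]
      refine Finset.sum_eq_zero fun j _ => ?_
      simp only [TensorProduct.smul_tmul', ← TensorProduct.sum_tmul, h2, TensorProduct.zero_tmul]
    choose! T hT hT' using key
    refine ⟨_, J.bind_covering (R := fun V g hg => T V g) hS fun V g hg => hT V g hg,
      fun W g hg => ?_⟩
    obtain ⟨V, g', g, hg, hg', rfl⟩ := hg
    exact hT' V g hg W g' hg'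
  surj U y := by
    change (sec N (op U) ⊗[R.obj (op U)] sec M' (op U) : Type _) at y
    change ∃ S ∈ J U, ∀ (V : C) (g : V ⟶ U), S g →
      ∃ x, (homLin f (op V)).lTensor (sec N (op V)) x = resTensor N M' g.op y
    induction y using TensorProduct.induction_on with
    | zero => exact ⟨⊤, J.top_mem U, fun V g _ => ⟨0, by simp only [map_zero]⟩⟩
    | add y z hy hz =>
      obtain ⟨S, hS, hS'⟩ := hy
      obtain ⟨T, hT, hT'⟩ := hz
      refine ⟨S ⊓ T, J.intersection_covering hS hT, fun V g hg => ?_⟩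
      obtain ⟨a, ha⟩ := hS' V g hg.1
      obtain ⟨b, hb⟩ := hT' V g hg.2
      exact ⟨a + b, by rw [map_add, ha, hb, map_add]⟩
    | tmul n y =>
      obtain ⟨S, hS, hS'⟩ := h.surj U y
      refine ⟨S, hS, fun V g hg => ?_⟩
      obtain ⟨a, ha⟩ := hS' V g hg
      exact ⟨res N g.op n ⊗ₜ a, by rw [LinearMap.lTensor_tmul, ha, resTensor_tmul]⟩

end Local

/-! ### Schur functors of sheaves of modules on a scheme -/

section Sheaf

open AlgebraicGeometry Opposite Limits TopologicalSpace

variable {X : Scheme.{u}}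

variable (X) in
/-- The sheafification functor for presheaves of modules on `X`. -/
abbrev sheafificationOn :
    PresheafOfModules.{u} X.ringCatSheaf.obj ⥤ SheafOfModules.{u} X.ringCatSheaf :=
  PresheafOfModules.sheafification (𝟙 X.ringCatSheaf.obj)

/-- The sheaf of modules associated with a presheaf of modules. -/
def shf : PMod X.presheaf ⥤ X.Modules := sheafificationOn X

/-- The presheaf of modules underlying a sheaf of modules. -/
def toP : X.Modules ⥤ PMod X.presheaf := Scheme.Modules.toPresheafOfModules X

/-- The sheafification map `P → P⁺`. -/
def unitShf (P : PMod X.presheaf) : P ⟶ toP.obj (shf.obj P) :=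
  (PresheafOfModules.sheafificationAdjunction (𝟙 X.ringCatSheaf.obj)).unit.app P

lemma isLocBij_unitShf (P : PMod X.presheaf) :
    IsLocBij (Opens.grothendieckTopology X) (unitShf P) := by
  rw [isLocBij_iff]
  have : (PresheafOfModules.toPresheaf _).map (unitShf P) =
    CategoryTheory.toSheafify (Opens.grothendieckTopology X) P.presheaf := rfl
  rw [this]
  exact (GrothendieckTopology.W_iff_isLocallyBijective _ _).1
    (GrothendieckTopology.W_toSheafify _ _)

lemma isIso_shf_map {P P' : PMod X.presheaf} {f : P ⟶ P'}
    (h : IsLocBij (Opens.grothendieckTopology X) f) : IsIso (shf.map f) := by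
  rw [isLocBij_iff] at h
  have h1 : (Opens.grothendieckTopology X).W ((PresheafOfModules.toPresheaf _).map f) :=
    (GrothendieckTopology.W_iff_isLocallyBijective _ _).2 h
  have h2 := PresheafOfModules.inverseImage_W_toPresheaf_eq_inverseImage_isomorphisms
    (𝟙 X.ringCatSheaf.obj)
  have h3 : ((Opens.grothendieckTopology X).W.inverseImage
    (PresheafOfModules.toPresheaf X.ringCatSheaf.obj)) f := h1
  rw [h2] at h3
  exact h3

/-- The tensor product of two sheaves of modules: the sheaf associated with
`U ↦ F(U) ⊗ G(U)`. -/
def tensor (F G : X.Modules) : X.Modules := shf.obj (toP.obj F ⊗ toP.obj G)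

/-- The tensor product of two morphisms. -/
def tensorMap {F F' G G' : X.Modules} (f : F ⟶ F') (g : G ⟶ G') : tensor F G ⟶ tensor F' G' :=
  shf.map (toP.map f ⊗ₘ toP.map g)

/-- The exchange of factors `F ⊗ G → G ⊗ F`. -/
def swap (F G : X.Modules) : tensor F G ⟶ tensor G F :=
  shf.map (β_ (toP.obj F) (toP.obj G)).hom

/-- The map `(P ⊗ P')⁺ → P⁺ ⊗ P'⁺`, which is an isomorphism. -/
def tensorShf (P P' : PMod X.presheaf) : shf.obj (P ⊗ P') ⟶ tensor (shf.obj P) (shf.obj P') :=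
  shf.map (unitShf P ⊗ₘ unitShf P')

instance (P P' : PMod X.presheaf) : IsIso (tensorShf P P') := by
  have h1 : ∀ (A B N : PMod X.presheaf) (f : A ⟶ B),
      IsLocBij (Opens.grothendieckTopology X) f → IsIso (shf.map (N ◁ f)) := fun A B N f h =>
    isIso_shf_map (isLocBij_whiskerLeft _ h N)
  have h2 : ∀ (A B N : PMod X.presheaf) (f : A ⟶ B),
      IsLocBij (Opens.grothendieckTopology X) f → IsIso (shf.map (f ▷ N)) := fun A B N f h => by
    have := h1 A B N f h
    have e : f ▷ N = (β_ A N).hom ≫ N ◁ f ≫ (β_ N B).hom := by simp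
    rw [e, Functor.map_comp, Functor.map_comp]
    infer_instance
  have h3 := h2 _ _ P' _ (isLocBij_unitShf P)
  have h4 := h1 _ _ (toP.obj (shf.obj P)) _ (isLocBij_unitShf P')
  rw [tensorShf, MonoidalCategory.tensorHom_def, Functor.map_comp]
  exact IsIso.comp_isIso' h3 h4

/-- The pairing of sheaves `P⁺ ⊗ P'⁺ → L⁺` induced by a pairing of presheaves. -/
def pairingShf {P P' L : PMod X.presheaf} (w : P ⊗ P' ⟶ L) :
    tensor (shf.obj P) (shf.obj P') ⟶ shf.obj L :=
  inv (tensorShf P P') ≫ shf.map w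

variable {k l : ℕ}

/-- The sheaf `⋀^{λᵗ} Q = ⋀^{λᵗ_1} Q ⊗ ⋯ ⊗ ⋀^{λᵗ_l} Q`. -/
def wedgeSheaf (lam : YoungIn k l) (Q : X.Modules) : X.Modules :=
  shf.obj (extTensor lam.col (toP.obj Q))

/-- The sheaf `Sym^λ Q = Sym^{λ_1} Q ⊗ ⋯ ⊗ Sym^{λ_k} Q`. -/
def symSheaf (lam : YoungIn k l) (Q : X.Modules) : X.Modules :=
  shf.obj (symTensor lam.row (toP.obj Q))

/-- The map `d_λ(Q) : ⋀^{λᵗ} Q → Sym^λ Q`. -/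
def dMap (lam : YoungIn k l) (Q : X.Modules) : wedgeSheaf lam Q ⟶ symSheaf lam Q :=
  shf.map (schurMap lam (toP.obj Q))

/-- The Schur functor `S^λ Q`, the image of `d_λ(Q)`. -/
def schur (lam : YoungIn k l) (Q : X.Modules) : X.Modules := image (dMap lam Q)

/-- The inclusion `S^λ Q → Sym^λ Q`. -/
def schurι (lam : YoungIn k l) (Q : X.Modules) : schur lam Q ⟶ symSheaf lam Q :=
  image.ι (dMap lam Q)

/-- The natural map `S^λ Q → ⋀^{λᵗ} Q`. For a vector bundle in characteristic zero it is the
isomorphism of the Schur functor `S^λ Q`, which is a quotient of `⋀^{λᵗ} Q` by `d_λ`, with the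
Weyl functor, which is a subsheaf of `⋀^{λᵗ} Q`; by the theory of Young symmetrizers, composing it
with `d_λ` gives a positive integer multiple of the identity of `S^λ Q`. -/
def schurToWedge (lam : YoungIn k l) (Q : X.Modules) : schur lam Q ⟶ wedgeSheaf lam Q :=
  schurι lam Q ≫ shf.map (weylMap lam (toP.obj Q))

/-- The sheaf `(det Q)^{⊗ l}`, where `det Q = ⋀^k Q`. -/
def detPow (k l : ℕ) (Q : X.Modules) : X.Modules :=
  shf.obj (tensorPow (Fin l) (extPow k (toP.obj Q)))

/-- The wedge pairing `⋀^{λᵗ} Q ⊗ ⋀^{λᵗ} Q → (det Q)^{⊗ l}`. -/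
def wedgeSheafPairing (lam : YoungIn k l) (h : lam.IsSymmetric) (Q : X.Modules) :
    tensor (wedgeSheaf lam Q) (wedgeSheaf lam Q) ⟶ detPow k l Q :=
  pairingShf (wedgePairing lam.col h.col_add_col (toP.obj Q))

/-- The canonical pairing `S^λ Q ⊗ S^λ Q → (det Q)^{⊗ l}`, induced by the wedge pairing on
`⋀^{λᵗ} Q`. The wedge pairing itself need not vanish on the kernel of `d_λ`, so it does not descend
along the quotient map `d_λ : ⋀^{λᵗ} Q → S^λ Q`; it is transported along the natural identification
of `S^λ Q` with the Weyl functor inside `⋀^{λᵗ} Q`, which is split by `d_λ` up to a non-zero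
rational factor. -/
def canonicalPairing (lam : YoungIn k l) (h : lam.IsSymmetric) (Q : X.Modules) :
    tensor (schur lam Q) (schur lam Q) ⟶ detPow k l Q :=
  tensorMap (schurToWedge lam Q) (schurToWedge lam Q) ≫ wedgeSheafPairing lam h Q

/-- A pairing is symmetric if it is invariant under the exchange of factors. -/
def IsSymmPairing {F L : X.Modules} (b : tensor F F ⟶ L) : Prop := swap F F ≫ b = b

/-- A pairing is skew-symmetric if the exchange of factors changes its sign. -/
def IsSkewPairing {F L : X.Modules} (b : tensor F F ⟶ L) : Prop := swap F F ≫ b = -b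

/-- A sheaf of modules is a vector bundle of rank `k` if near every point it has `k` sections
which form a basis of the sections over every smaller open set. -/
def IsVectorBundle (Q : X.Modules) (k : ℕ) : Prop :=
  ∀ x : X, ∃ (U : X.Opens) (_ : x ∈ U) (e : Fin k → sec (toP.obj Q) (op U)),
    ∀ (V : X.Opens) (i : V ⟶ U),
      LinearIndependent (X.presheaf.obj (op V)) (fun j => res (toP.obj Q) i.op (e j)) ∧
      Submodule.span (X.presheaf.obj (op V))
        (Set.range fun j => res (toP.obj Q) i.op (e j)) = ⊤

end Sheaf

end SchurPairing

end

noncomputable section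

namespace SchurPairing

open CategoryTheory MonoidalCategory TensorProduct PiTensorProduct

/-! ### Symmetry of the wedge pairing on modules -/

section Linear

variable {A : Type*} [CommRing A] {M : Type*} [AddCommGroup M] [Module A M]

/-! The canonical pairing is the wedge pairing ω precomposed with the same map on both arguments, so
by naturality of the exchange of factors it inherits whatever symmetry ω has. Everything reduces to
comparing ω(y, x) with ω(x, y). Write μ for the column lengths and `rev` for the reversal of the
indices. The factor of ω(y, x) at place j is y_j ∧ x_{rev j}. By graded commutativity it equals
x_{rev j} ∧ y_j, which is the factor of ω(x, y) at place `rev j`, times the sign (-1)^(μ_j μ_{rev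
j}). Hence ω(y, x) is ω(x, y) with its factors reversed, times the product of these signs
(`wedgePairingLin_swap`). The reversal has no effect: where the bundle has k generators, its k-th
exterior power is cyclic, and permutations act trivially on tensor powers of a cyclic module
(`reindex_eq_self_of_span_singleton`). In the product of signs, the places j and `rev j` carry equal
signs, which cancel if the places differ. A middle place exists only for an odd number of columns.
There k = 2 μ_j and the sign is (-1)^((k/2)^2), which is -1 exactly when k ≡ 2 mod 4
(`prod_neg_one_pow`). Generators exist only locally, so the identity of presheaf maps holds only on
small open sets. This suffices after sheafification (`shf_map_eq_of_locally_eq`). -/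

lemma ι_mul_ιMulti (m : M) {n : ℕ} (x : Fin n → M) :
    ExteriorAlgebra.ι A m * ExteriorAlgebra.ιMulti A n x =
      (-1 : A) ^ n • (ExteriorAlgebra.ιMulti A n x * ExteriorAlgebra.ι A m) := by
  induction n with
  | zero => simp
  | succ n ih =>
    rw [ExteriorAlgebra.ιMulti_succ_apply, ← mul_assoc,
      eq_neg_of_add_eq_zero_left (ExteriorAlgebra.ι_add_mul_swap m (x 0)), neg_mul, mul_assoc, ih,
      mul_smul_comm, mul_assoc, pow_succ, mul_neg_one, neg_smul]

/-- Each of the a vectors of x is moved past the whole product of the y's at the cost of (-1)^b. -/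
lemma ιMulti_mul_comm {a b : ℕ} (x : Fin a → M) (y : Fin b → M) :
    ExteriorAlgebra.ιMulti A a x * ExteriorAlgebra.ιMulti A b y =
      (-1 : A) ^ (a * b) • (ExteriorAlgebra.ιMulti A b y * ExteriorAlgebra.ιMulti A a x) := by
  induction a with
  | zero => simp
  | succ a ih =>
    rw [ExteriorAlgebra.ιMulti_succ_apply, mul_assoc, ih, mul_smul_comm, ← mul_assoc,
      ι_mul_ιMulti, smul_mul_assoc, smul_smul, mul_assoc, ← pow_add]
    congr 2
    ring

/-- By bilinearity it suffices to treat products of vectors, inside the exterior algebra. The common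
degree c, with separate proofs `h` and `h'`, places both products in the same module. -/
lemma wedgeLin_comm {a b c : ℕ} (h : a + b = c) (h' : b + a = c) (x : ⋀[A]^a M) (y : ⋀[A]^b M) :
    wedgeLin h x y = (-1 : A) ^ (a * b) • wedgeLin h' y x := by
  induction x using ext_induction with
  | h r x =>
    induction y using ext_induction with
    | h s y =>
      have key : wedgeLin h (exteriorPower.ιMulti A a x) (exteriorPower.ιMulti A b y) =
          (-1 : A) ^ (a * b) •
            wedgeLin h' (exteriorPower.ιMulti A b y) (exteriorPower.ιMulti A a x) :=
        Subtype.ext (ιMulti_mul_comm x y)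
      simp only [map_smul, LinearMap.smul_apply, key, smul_smul]
      congr 1
      ring
    | hadd y z hy hz => simp only [map_add, LinearMap.add_apply, hy, hz, smul_add]
  | hadd x z hx hz => simp only [map_add, LinearMap.add_apply, hx, hz, smul_add]

/-- The wedge pairing is symmetric up to sign and the reversal of the factors of the target. -/
lemma wedgePairingLin_swap {m k : ℕ} (μ : Fin m → ℕ) (hμ : ∀ j, μ j + μ (Fin.rev j) = k)
    (x y : ⨂[A] j, ⋀[A]^(μ j) M) :
    wedgePairingLin A M μ hμ y x =
      (∏ j, (-1 : A) ^ (μ j * μ (Fin.rev j))) •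
        PiTensorProduct.reindex A (fun _ : Fin m => ⋀[A]^k M) Fin.revPerm
          (wedgePairingLin A M μ hμ x y) := by
  induction x using PiTensorProduct.induction_on with
  | smul_tprod r x =>
    induction y using PiTensorProduct.induction_on with
    | smul_tprod s y =>
      have key : wedgePairingLin A M μ hμ (PiTensorProduct.tprod A y) (PiTensorProduct.tprod A x) =
          (∏ j, (-1 : A) ^ (μ j * μ (Fin.rev j))) •
            PiTensorProduct.reindex A (fun _ : Fin m => ⋀[A]^k M) Fin.revPerm
              (wedgePairingLin A M μ hμ (PiTensorProduct.tprod A x)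
                (PiTensorProduct.tprod A y)) := by
        -- Both sides become pure tensors once each sign is absorbed into its own factor, so the
        -- comparison can be made place by place.
        rw [wedgePairingLin_tprod, wedgePairingLin_tprod, PiTensorProduct.reindex_tprod,
          ← MultilinearMap.map_smul_univ]
        congr 1
        ext1 j
        change wedgeLin (hμ j) (y j) (x (Fin.rev j)) =
          (-1 : A) ^ (μ j * μ (Fin.rev j)) •
            wedgeLin (hμ (Fin.rev j)) (x (Fin.rev j)) (y (Fin.rev (Fin.rev j)))
        -- `Fin.rev (Fin.rev j)` equals `j` only propositionally, and the degree of the exterior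
        -- power depends on it. Generalizing it to a variable `i` allows substitution.
        have comm : ∀ i, i = j → ∀ h : μ (Fin.rev j) + μ i = k,
            wedgeLin (hμ j) (y j) (x (Fin.rev j)) =
              (-1 : A) ^ (μ j * μ (Fin.rev j)) • wedgeLin h (x (Fin.rev j)) (y i) := by
          rintro _ rfl h
          exact wedgeLin_comm _ _ _ _
        exact comm _ (Fin.rev_rev j) _
      simp only [map_smul, LinearMap.smul_apply, key, smul_smul]
      congr 1
      ring
    | add y z hy hz => simp only [map_add, LinearMap.add_apply, hy, hz, smul_add]
  | add x z hx hz => simp only [map_add, LinearMap.add_apply, hx, hz, smul_add]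

/-- Permutations of the factors act trivially on a tensor power of a cyclic module. -/
lemma reindex_eq_self_of_span_singleton {v : M} (hv : Submodule.span A {v} = ⊤) {ι : Type*}
    [Fintype ι] (σ : Equiv.Perm ι) (t : ⨂[A] _ : ι, M) :
    PiTensorProduct.reindex A (fun _ : ι => M) σ t = t := by
  induction t using PiTensorProduct.induction_on with
  | smul_tprod r x =>
    -- With x_i = c_i v the pure tensor is (∏ c_i) times v ⊗ ⋯ ⊗ v, and a permutation merely
    -- reorders the scalar product.
    choose c hc using fun i => Submodule.mem_span_singleton.1 (hv ▸ Submodule.mem_top : x i ∈ _)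
    obtain rfl : (fun i => c i • v) = x := funext hc
    rw [map_smul, PiTensorProduct.reindex_tprod, MultilinearMap.map_smul_univ,
      MultilinearMap.map_smul_univ (PiTensorProduct.tprod A) c, Equiv.prod_comp σ.symm c]
  | add x y hx hy => rw [map_add, hx, hy]

/-- The top exterior power of a module with `k` generators is cyclic. -/
lemma span_ιMulti_eq_top {k : ℕ} {e : Fin k → M} (he : Submodule.span A (Set.range e) = ⊤) :
    Submodule.span A {exteriorPower.ιMulti A k e} = ⊤ := by
  rw [eq_top_iff, ← exteriorPower.ιMulti_family_span_of_span A he]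
  refine Submodule.span_mono ?_
  rintro _ ⟨s, rfl⟩
  -- The spanning family is indexed by the k-element subsets of a k-element set. The only increasing
  -- enumeration of such a subset is the identity.
  have h : ⇑(Set.powersetCard.ofFinEmbEquiv.symm s) = id := by
    have hs := (Set.powersetCard.ofFinEmbEquiv.symm s).strictMono
    refine StrictMono.range_inj hs strictMono_id |>.1 ?_
    rw [(Finite.injective_iff_surjective.1 hs.injective).range_eq, Set.range_id]
  rw [exteriorPower.ιMulti_family, h, Function.comp_id]
  rfl

/-- The sign of the exchange of factors in the wedge pairing. -/
lemma prod_neg_one_pow {m k : ℕ} (μ : Fin m → ℕ) (hμ : ∀ j, μ j + μ (Fin.rev j) = k) :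
    ∏ j, (-1 : A) ^ (μ j * μ (Fin.rev j)) = if Odd m ∧ k ≡ 2 [MOD 4] then -1 else 1 := by
  have h1 : ∀ j, (-1 : A) ^ (μ j * μ (Fin.rev j)) *
      (-1 : A) ^ (μ (Fin.rev j) * μ (Fin.rev (Fin.rev j))) = 1 := fun j => by
    rw [Fin.rev_rev, mul_comm (μ (Fin.rev j)), ← mul_pow, neg_one_mul, neg_neg, one_pow]
  -- A place fixed by the reversal is the middle one, and there `hμ` reads μ_j + μ_j = k.
  have h2 : ∀ j, Fin.rev j = j → m = 2 * j + 1 ∧ k = 2 * μ j := fun j hj => by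
    have h := hμ j
    have h' := Fin.val_rev j
    rw [hj] at h h'
    omega
  split_ifs with h
  · obtain ⟨⟨a, rfl⟩, hk⟩ := h
    let j : Fin (2 * a + 1) := ⟨a, by omega⟩
    have hj : Fin.rev j = j := Fin.ext (by simp only [Fin.val_rev, j]; omega)
    -- The middle factor is split off. The reversal acts without fixed points on the remaining
    -- places, so their signs cancel in pairs.
    rw [← Finset.mul_prod_erase _ _ (Finset.mem_univ j),
      Finset.prod_involution (fun i _ => Fin.rev i) (fun i _ => h1 i) (fun i hi _ hi' => ?_)
        (fun i hi => ?_) (fun i _ => Fin.rev_rev i), mul_one, hj]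
    -- Since k = 2 μ_j and k ≡ 2 mod 4, the middle exponent μ_j² is odd.
    · have h3 : Odd (μ j) := by
        have := (h2 j hj).2
        rw [Nat.odd_iff]
        unfold Nat.ModEq at hk
        omega
      exact (h3.mul h3).neg_one_pow
    · have := (h2 i hi').1
      exact (Finset.mem_erase.1 hi).1 (Fin.ext (by simp only [j]; omega))
    · refine Finset.mem_erase.2 ⟨fun h' => (Finset.mem_erase.1 hi).1 ?_, Finset.mem_univ _⟩
      rw [← Fin.rev_rev i, h', hj]
  · refine Finset.prod_involution (fun i _ => Fin.rev i) (fun i _ => h1 i) (fun i _ hi hi' => hi ?_)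
      (fun i _ => Finset.mem_univ _) (fun i _ => Fin.rev_rev i)
    -- A fixed place makes m odd, so k ≢ 2 mod 4 by assumption. Then μ_i = k/2 is even, and the
    -- unpaired sign is 1.
    obtain ⟨h3, h4⟩ := h2 i hi'
    have h5 : Even (μ i) := by
      rw [← Nat.not_odd_iff_even]
      intro h6
      refine h ⟨⟨i, h3⟩, ?_⟩
      rw [Nat.odd_iff] at h6
      unfold Nat.ModEq
      omega
    exact (h5.mul_right _).neg_one_pow

/-- Over a module with `k` generators, the wedge pairing is symmetric up to sign. -/
lemma wedgePairingLin_comm {m k : ℕ} (μ : Fin m → ℕ) (hμ : ∀ j, μ j + μ (Fin.rev j) = k)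
    {e : Fin k → M} (he : Submodule.span A (Set.range e) = ⊤) (x y : ⨂[A] j, ⋀[A]^(μ j) M) :
    wedgePairingLin A M μ hμ y x = if Odd m ∧ k ≡ 2 [MOD 4] then -wedgePairingLin A M μ hμ x y
      else wedgePairingLin A M μ hμ x y := by
  rw [wedgePairingLin_swap, reindex_eq_self_of_span_singleton (span_ιMulti_eq_top he),
    prod_neg_one_pow μ hμ]
  split_ifs
  · have h := neg_one_smul A (wedgePairingLin A M μ hμ x y)
    exact h
  · exact one_smul A _

end Linear

/-! ### Symmetry of the wedge pairing on presheaves -/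

section Presheaf

universe v₁ u₁

variable {C : Type u₁} [Category.{v₁} C] {R : Cᵒᵖ ⥤ CommRingCat.{u}}

/-- The tensor product of presheaves is formed section by section, so over each U pure tensors
suffice. -/
lemma homLin_tensor_ext {M N L : PMod R} {f g : M ⊗ N ⟶ L} {U : Cᵒᵖ}
    (h : ∀ (x : sec M U) (y : sec N U),
      homLin f U (x ⊗ₜ[R.obj U] y) = homLin g U (x ⊗ₜ[R.obj U] y)) :
    homLin f U = homLin g U :=
  TensorProduct.ext' h

lemma homLin_braiding_comp_tmul {M N L : PMod R} (w : N ⊗ M ⟶ L) (U : Cᵒᵖ) (x : sec M U)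
    (y : sec N U) :
    homLin ((β_ M N).hom ≫ w) U (x ⊗ₜ[R.obj U] y) = homLin w U (y ⊗ₜ[R.obj U] x) :=
  rfl

/-- On sections over which `M` has `k` generators, the wedge pairing is symmetric up to sign. -/
lemma homLin_braiding_comp_wedgePairing {m k : ℕ} (μ : Fin m → ℕ)
    (hμ : ∀ j, μ j + μ (Fin.rev j) = k) (M : PMod R) (U : Cᵒᵖ) (e : Fin k → sec M U)
    (he : Submodule.span (R.obj U) (Set.range e) = ⊤) :
    homLin ((β_ _ _).hom ≫ wedgePairing μ hμ M) U =
      homLin (if Odd m ∧ k ≡ 2 [MOD 4] then -wedgePairing μ hμ M else wedgePairing μ hμ M) U := by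
  refine homLin_tensor_ext fun x y => ?_
  have h := wedgePairingLin_comm (A := R.obj U) μ hμ he x y
  refine (homLin_braiding_comp_tmul _ _ _ _).trans (h.trans ?_)
  split_ifs <;> rfl

end Presheaf

/-! ### Symmetry of the canonical pairing -/

section Sheaf

open AlgebraicGeometry Opposite Limits TopologicalSpace

variable {X : Scheme.{u}}

/-- Morphisms of presheaves that agree locally induce the same morphism of sheaves. -/
lemma shf_map_eq_of_locally_eq {P L : PMod X.presheaf} (f g : P ⟶ L)
    (h : ∀ (U : X.Opens) (s : sec P (op U)) (x : X), x ∈ U →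
      ∃ (V : X.Opens) (i : V ⟶ U), x ∈ V ∧
        homLin f (op V) (res P i.op s) = homLin g (op V) (res P i.op s)) :
    shf.map f = shf.map g := by
  -- After composition with the unit the values lie in a sheaf, where equality can be tested on the
  -- cover of U by the neighbourhoods chosen for its points.
  have key : f ≫ unitShf L = g ≫ unitShf L := by
    ext U s
    induction U using Opposite.rec with | op U
    choose V i hx hV using h U s
    refine TopCat.Sheaf.eq_of_locally_eq'
      (⟨(Scheme.Modules.toPresheaf X).obj (shf.obj L), (shf.obj L).isSheaf⟩ :
        TopCat.Sheaf Ab X) (fun x : U => V x x.2) U (fun x => i x x.2)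
        (fun x hxU => Opens.mem_iSup.2 ⟨⟨x, hxU⟩, hx x hxU⟩) _ _ fun x => ?_
    change res (toP.obj (shf.obj L)) _ (homLin (unitShf L) _ (homLin f _ s)) =
      res (toP.obj (shf.obj L)) _ (homLin (unitShf L) _ (homLin g _ s))
    rw [← homLin_res, ← homLin_res, ← homLin_res, ← homLin_res, hV]
  -- A morphism out of a sheafification is determined by its composite with the unit, which for
  -- `shf.map f` is `f ≫ unitShf L` by naturality.
  refine ((PresheafOfModules.sheafificationAdjunction
    (𝟙 X.ringCatSheaf.obj)).homEquiv _ _).injective ?_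
  have nat (f : P ⟶ L) := (PresheafOfModules.sheafificationAdjunction
    (𝟙 X.ringCatSheaf.obj)).unit.naturality f
  exact (Adjunction.homEquiv_unit _ _ _ _).trans
    ((nat f).symm.trans (key.trans ((nat g).trans (Adjunction.homEquiv_unit _ _ _ _).symm)))

/-! ### Sheafification, signs and the exchange of factors -/

instance : (shf (X := X)).Additive :=
  have : (SheafOfModules.forget X.ringCatSheaf ⋙
    PresheafOfModules.restrictScalars (𝟙 X.ringCatSheaf.obj)).Additive := inferInstance
  (PresheafOfModules.sheafificationAdjunction (𝟙 X.ringCatSheaf.obj)).left_adjoint_additive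

lemma tensorMap_comp_swap {F F' G G' : X.Modules} (f : F ⟶ F') (g : G ⟶ G') :
    tensorMap f g ≫ swap F' G' = swap F G ≫ tensorMap g f :=
  (shf.map_comp _ _).symm.trans ((congrArg shf.map
    (BraidedCategory.braiding_naturality (toP.map f) (toP.map g))).trans (shf.map_comp _ _))

/-- `pairingShf` involves the inverse of `tensorShf`. By naturality of the braiding `tensorShf`
commutes with the exchange, and as an isomorphism it can be cancelled. -/
lemma swap_comp_pairingShf {P L : PMod X.presheaf} (w : P ⊗ P ⟶ L) :
    swap (shf.obj P) (shf.obj P) ≫ pairingShf w = pairingShf ((β_ P P).hom ≫ w) := by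
  have h : tensorShf P P ≫ swap _ _ = shf.map (β_ P P).hom ≫ tensorShf P P :=
    (shf.map_comp _ _).symm.trans ((congrArg shf.map
      (BraidedCategory.braiding_naturality (unitShf P) (unitShf P))).trans (shf.map_comp _ _))
  rw [pairingShf, pairingShf, ← cancel_epi (tensorShf P P), reassoc_of% h]
  simp

/-! ### Pairings of vector bundles -/

variable {k l : ℕ}

/-- For a vector bundle of rank `k`, the wedge pairing is symmetric up to sign. -/
lemma shf_map_braiding_comp_wedgePairing {Q : X.Modules} (hQ : IsVectorBundle Q k)
    (μ : Fin l → ℕ) (hμ : ∀ j, μ j + μ (Fin.rev j) = k) :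
    shf.map ((β_ _ _).hom ≫ wedgePairing μ hμ (toP.obj Q)) =
      if Odd l ∧ k ≡ 2 [MOD 4] then -shf.map (wedgePairing μ hμ (toP.obj Q))
      else shf.map (wedgePairing μ hμ (toP.obj Q)) := by
  -- The sign is first kept inside `shf.map`, so that the identity can be checked locally on
  -- presheaf maps. Additivity of `shf` extracts it afterwards.
  have key : shf.map ((β_ _ _).hom ≫ wedgePairing μ hμ (toP.obj Q)) =
      shf.map (if Odd l ∧ k ≡ 2 [MOD 4] then -wedgePairing μ hμ (toP.obj Q)
        else wedgePairing μ hμ (toP.obj Q)) := by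
    refine shf_map_eq_of_locally_eq _ _ fun U s x hx => ?_
    obtain ⟨U', hx', e, he⟩ := hQ x
    -- The section lives over U and the frame of Q over U', so both are restricted to the
    -- intersection.
    refine ⟨U ⊓ U', homOfLE inf_le_left, ⟨hx, hx'⟩, ?_⟩
    exact LinearMap.congr_fun (homLin_braiding_comp_wedgePairing μ hμ (toP.obj Q) _ _
      (he (U ⊓ U') (homOfLE inf_le_right)).2) _
  rw [key]
  split_ifs
  · rw [Functor.map_neg]
  · rfl

lemma swap_comp_wedgeSheafPairing {Q : X.Modules} (hQ : IsVectorBundle Q k) (lam : YoungIn k l)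
    (hlam : lam.IsSymmetric) :
    swap _ _ ≫ wedgeSheafPairing lam hlam Q = if Odd l ∧ k ≡ 2 [MOD 4]
      then -wedgeSheafPairing lam hlam Q else wedgeSheafPairing lam hlam Q := by
  refine (swap_comp_pairingShf _).trans ?_
  rw [pairingShf, shf_map_braiding_comp_wedgePairing hQ lam.col hlam.col_add_col]
  split_ifs
  · exact Preadditive.comp_neg _ _
  · rfl

/-- The canonical pairing of a vector bundle of rank `k` is symmetric up to sign. -/
lemma swap_comp_canonicalPairing {Q : X.Modules} (hQ : IsVectorBundle Q k) (lam : YoungIn k l)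
    (hlam : lam.IsSymmetric) :
    swap _ _ ≫ canonicalPairing lam hlam Q = if Odd l ∧ k ≡ 2 [MOD 4]
      then -canonicalPairing lam hlam Q else canonicalPairing lam hlam Q := by
  -- Both arguments pass through the same map `schurToWedge`, so moving the exchange across it
  -- changes nothing and the sign of the wedge pairing carries over.
  rw [canonicalPairing, ← Category.assoc, ← tensorMap_comp_swap, Category.assoc,
    swap_comp_wedgeSheafPairing hQ]
  split_ifs
  · rw [Preadditive.comp_neg]
  · rfl

end Sheaf

end SchurPairing

end

theorem proposition2p7 {F : Type u} [Field F] [CharZero F]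
    (X : AlgebraicGeometry.Scheme.{u})
    (_f : X ⟶ AlgebraicGeometry.Spec (CommRingCat.of F))
    (k n : ℕ) (hkn : k ≤ n) (heven : Even (k * (n - k)))
    (Q : X.Modules) (hQ : SchurPairing.IsVectorBundle Q k)
    (lam : SchurPairing.YoungIn k (n - k)) (hlam : lam.IsSymmetric) :
    ((Odd (n - k) ∧ k ≡ 2 [MOD 4]) →
      SchurPairing.IsSkewPairing (SchurPairing.canonicalPairing lam hlam Q)) ∧
    (¬ (Odd (n - k) ∧ k ≡ 2 [MOD 4]) →
      SchurPairing.IsSymmPairing (SchurPairing.canonicalPairing lam hlam Q)) := by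
  have h := SchurPairing.swap_comp_canonicalPairing hQ lam hlam
  exact ⟨fun h' => h.trans (if_pos h'), fun h' => h.trans (if_neg h')⟩
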